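/- Let $f:\mathbb{N}_{\ge 1}\to\mathbb{R}$ be a real additive arithmetic function, i.e. $f(1)=0$ and $f(mn)=f(m)+f(n)$ whenever $\gcd(m,n)=1$. Suppose that for every real $t$ $$\sum_{p}\sum_{\alpha\ge 1}\frac{\left|e^{itf(p^\alpha)}-e^{itf(p^{\alpha-1})}\right|}{p^\alpha}<\infty ,$$ where $p$ runs over the primes. Then $f$ has a limit distribution: there is a probability distribution function $F$ on $\mathbb{R}$ such that $$F_n(y)=\frac1n\,\#\{1\le m\le n:\ f(m)\le y\}\ \longrightarrow\ F(y)\qquad(n\to\infty)$$ at every continuity point $y$ of $F$. Moreover, for every real $t$, the characteristic function $\varphi_f(t)=\int_{\mathbb{R}}e^{itx}\,dF(x)$ of this limit distribution is $$\varphi_f(t)=\prod_p\left(1-\frac1p\right)\sum_{\alpha\ge 0}\frac{e^{itf(p^\alpha)}}{p^\alpha},$$ where the product over primes converges unconditionally (as the limit of its finite partial products; the value $0$ is allowed). -/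

import Mathlib

open Filter Topology MeasureTheory ProbabilityTheory

/-- A real arithmetic function is additive if `f 1 = 0` and `f (m * n) = f m + f n` for
coprime `m`, `n`. (The value at `0` plays no role.) -/
def IsAdditiveArith (f : ArithmeticFunction ℝ) : Prop :=
  f 1 = 0 ∧ ∀ m n : ℕ, Nat.Coprime m n → f (m * n) = f m + f n

/-- The distribution function `F_n(y) = #{m ≤ n : f(m) ≤ y} / n` of `f` on `{1, …, n}` with the
uniform probability. -/
noncomputable def empiricalCDF (f : ArithmeticFunction ℝ) (n : ℕ) (y : ℝ) : ℝ :=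
  (((Finset.Icc 1 n).filter (fun m => f m ≤ y)).card : ℝ) / (n : ℝ)

/-- `μ` is the limit distribution of `f`: it is a probability measure on the line, and the
distribution functions `F_n` converge weakly to that of `μ`, i.e. at each of its continuity
points. -/
def HasLimitDistribution (f : ArithmeticFunction ℝ) (μ : Measure ℝ) : Prop :=
  IsProbabilityMeasure μ ∧
    ∀ y : ℝ, ContinuousAt (cdf μ) y →
      Tendsto (fun n : ℕ => empiricalCDF f n y) atTop (𝓝 (cdf μ y))

/-- `e^{i t f(n)}`. -/
noncomputable def expTwist (f : ArithmeticFunction ℝ) (t : ℝ) (n : ℕ) : ℂ :=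
  Complex.exp (Complex.I * (t : ℂ) * ((f n : ℝ) : ℂ))

/-- The local factor `(1 - 1/p) ∑_{α ≥ 0} e^{i t f(p^α)} / p^α`. For a prime `p` the series is
dominated by a convergent geometric series. -/
noncomputable def localFactor (f : ArithmeticFunction ℝ) (t : ℝ) (p : ℕ) : ℂ :=
  (1 - 1 / (p : ℂ)) * ∑' α : ℕ, expTwist f t (p ^ α) / (p : ℂ) ^ α

/-! Write `e^{itf} = h_t * ζ`. The function `h_t` is multiplicative and `h_t(p^(k+1))` is the
difference in the hypothesis, so `∑ h_t(d)/d` converges absolutely. Its sum `φ(t)` is the mean value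
of `e^{itf}` by Wintner's theorem, and its Euler product is the stated one. Lévy's theorem then
gives the limit law, once `φ` is continuous at `0`.

This continuity is the delicate point, since the hypothesis is only pointwise in `t`. If `S(t)` is
the sum in the hypothesis, then `|φ(t) - 1| ≤ exp(S(t)) - 1`, so `S(t) → 0` suffices
(`tendsto_tsum_chord`). Baire bounds `S` near `0`; averaging this bound over `t` produces a summable
majorant independent of `t`. -/

/-- The chord length `‖e^{ix} - 1‖` is at least `1 - cos x`. -/
lemma one_sub_cos_le_norm_exp_I_mul_sub_one (x : ℝ) :
    1 - Real.cos x ≤ ‖Complex.exp (Complex.I * x) - 1‖ := by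
  rw [Complex.norm_exp_I_mul_ofReal_sub_one, Real.norm_eq_abs, abs_mul, abs_two]
  have h : Real.cos x = 1 - 2 * Real.sin (x / 2) ^ 2 := by
    rw [← Real.cos_sq_add_sin_sq (x / 2)]
    nth_rewrite 1 [show x = 2 * (x / 2) by ring]
    rw [Real.cos_two_mul']
    ring
  have h1 := Real.abs_sin_le_one (x / 2)
  have h2 := abs_nonneg (Real.sin (x / 2))
  rw [h, ← sq_abs]
  nlinarith

lemma norm_exp_I_mul_sub_one_le_two (x : ℝ) : ‖Complex.exp (Complex.I * x) - 1‖ ≤ 2 := by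
  rw [Complex.norm_exp_I_mul_ofReal_sub_one, Real.norm_eq_abs, abs_mul, abs_two]
  linarith [Real.abs_sin_le_one (x / 2)]

/-- For `|x| ≤ 2` the chord length is at least `2 |x| / π`. -/
lemma abs_le_mul_norm_exp_I_mul_sub_one {x : ℝ} (hx : |x| ≤ 2) :
    |x| ≤ Real.pi / 2 * ‖Complex.exp (Complex.I * x) - 1‖ := by
  rw [Complex.norm_exp_I_mul_ofReal_sub_one, Real.norm_eq_abs, abs_mul, abs_two]
  have hpi := Real.pi_gt_three
  have h := Real.mul_abs_le_abs_sin (x := x / 2) (by rw [abs_div, abs_two]; linarith)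
  rw [abs_div, abs_two] at h
  have h2 := mul_le_mul_of_nonneg_left h Real.pi_pos.le
  calc |x| = Real.pi * (2 / Real.pi * (|x| / 2)) := by field_simp
    _ ≤ _ := h2
    _ = _ := by ring

lemma norm_exp_I_mul_sub_sub_one_le (x y : ℝ) :
    ‖Complex.exp (Complex.I * ((x - y : ℝ) : ℂ)) - 1‖ ≤
      ‖Complex.exp (Complex.I * x) - 1‖ + ‖Complex.exp (Complex.I * y) - 1‖ := by
  have h : Complex.exp (Complex.I * ((x - y : ℝ) : ℂ)) - 1 =
      (Complex.exp (Complex.I * x) - Complex.exp (Complex.I * y)) *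
        Complex.exp (Complex.I * ((-y : ℝ) : ℂ)) := by
    rw [sub_mul, ← Complex.exp_add, ← Complex.exp_add]
    push_cast
    rw [← mul_add, ← mul_add, ← sub_eq_add_neg, ← sub_eq_add_neg, sub_self, mul_zero,
      Complex.exp_zero]
  rw [h, norm_mul, Complex.norm_exp_I_mul_ofReal, mul_one]
  calc _ = ‖(Complex.exp (Complex.I * x) - 1) - (Complex.exp (Complex.I * y) - 1)‖ := by
        congr 1; ring
    _ ≤ _ := norm_sub_le _ _

/-! ### Sums of chord lengths near `t = 0` -/

section WeightedChords

variable {ι : Type*} {w a : ι → ℝ}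

/-- A pointwise finite weighted sum of chord lengths is bounded near `0`, by the Baire category
theorem. -/
lemma exists_tsum_chord_le (hw : ∀ j, 0 ≤ w j)
    (hs : ∀ t : ℝ, Summable fun j => w j * ‖Complex.exp (Complex.I * ((t * a j : ℝ) : ℂ)) - 1‖) :
    ∃ δ > 0, ∃ K : ℝ, ∀ t : ℝ, |t| ≤ δ →
      ∑' j, w j * ‖Complex.exp (Complex.I * ((t * a j : ℝ) : ℂ)) - 1‖ ≤ K := by
  set S : ℝ → ℝ := fun t => ∑' j, w j * ‖Complex.exp (Complex.I * ((t * a j : ℝ) : ℂ)) - 1‖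
    with hS
  have hnn : ∀ t j, 0 ≤ w j * ‖Complex.exp (Complex.I * ((t * a j : ℝ) : ℂ)) - 1‖ :=
    fun t j => mul_nonneg (hw j) (norm_nonneg _)
  have hclosed : ∀ M : ℕ, IsClosed {t | S t ≤ M} := by
    intro M
    have : {t | S t ≤ M} = ⋂ F : Finset ι,
        {t : ℝ | ∑ j ∈ F, w j * ‖Complex.exp (Complex.I * ((t * a j : ℝ) : ℂ)) - 1‖ ≤ M} := by
      ext t
      simp only [Set.mem_ofPred_eq, Set.mem_iInter]
      exact ⟨fun h F => ((hs t).sum_le_tsum F fun j _ => hnn t j).trans h,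
        fun h => (hs t).tsum_le_of_sum_le h⟩
    rw [this]
    refine isClosed_iInter fun F => isClosed_le ?_ continuous_const
    fun_prop
  obtain ⟨M, c, hc⟩ := nonempty_interior_of_iUnion_of_closed hclosed (by
    ext t
    simpa using exists_nat_ge (S t))
  obtain ⟨r, hr, hball⟩ := Metric.isOpen_iff.1 isOpen_interior c hc
  refine ⟨r / 2, by positivity, M + M, fun t ht => ?_⟩
  -- Baire's ball is centred at `c`; subadditivity of chords gives `S t ≤ S (c + t) + S c`, which
  -- moves the bound to `0`.
  have hmem : c + t ∈ Metric.ball c r := by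
    rw [Metric.mem_ball, Real.dist_eq, add_sub_cancel_left]
    linarith
  have h1 : S (c + t) ≤ M := interior_subset (s := {t | S t ≤ M}) (hball hmem)
  have h2 : S c ≤ M := interior_subset (s := {t | S t ≤ M}) hc
  refine le_trans ?_ (add_le_add h1 h2)
  rw [hS, ← (hs _).tsum_add (hs _)]
  refine (hs t).tsum_le_tsum (fun j => ?_) ((hs _).add (hs _))
  rw [← mul_add]
  refine mul_le_mul_of_nonneg_left ?_ (hw j)
  have := norm_exp_I_mul_sub_sub_one_le ((c + t) * a j) (c * a j)
  rwa [show (c + t) * a j - c * a j = t * a j by ring] at this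

/-- The integral is `δ - sin(δb)/b`, and `1/|b| ≤ δ/2`. -/
lemma half_le_integral_one_sub_cos {δ b : ℝ} (hδ : 0 < δ) (hb : 2 ≤ δ * |b|) :
    δ / 2 ≤ ∫ t in (0 : ℝ)..δ, (1 - Real.cos (t * b)) := by
  have hb0 : 0 < |b| := pos_of_mul_pos_right (by linarith) hδ.le
  have hb' : b ≠ 0 := abs_pos.1 hb0
  rw [intervalIntegral.integral_sub (by simp)
    (Continuous.intervalIntegrable (by fun_prop) _ _),
    intervalIntegral.integral_comp_mul_right _ hb']
  simp only [integral_cos, zero_mul, Real.sin_zero, sub_zero, intervalIntegral.integral_const,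
    smul_eq_mul, mul_one]
  have h : b⁻¹ * Real.sin (δ * b) ≤ δ / 2 := by
    refine (le_abs_self _).trans ?_
    rw [abs_mul, abs_inv]
    calc |b|⁻¹ * |Real.sin (δ * b)| ≤ |b|⁻¹ * 1 := by
          gcongr; exact Real.abs_sin_le_one _
      _ ≤ δ / 2 := by
          rw [mul_one, inv_le_iff_one_le_mul₀ hb0]; linarith
  linarith

/-- A pointwise finite weighted sum of chord lengths tends to `0` at `0`. -/
lemma tendsto_tsum_chord (hw : ∀ j, 0 ≤ w j)
    (hs : ∀ t : ℝ, Summable fun j => w j * ‖Complex.exp (Complex.I * ((t * a j : ℝ) : ℂ)) - 1‖) :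
    Tendsto (fun t : ℝ => ∑' j, w j * ‖Complex.exp (Complex.I * ((t * a j : ℝ) : ℂ)) - 1‖)
      (𝓝 0) (𝓝 0) := by
  obtain ⟨δ, hδ, K, hK⟩ := exists_tsum_chord_le hw hs
  have hint : ∀ j, IntervalIntegrable (fun t : ℝ => w j * (1 - Real.cos (t * a j))) volume 0 δ :=
    fun j => Continuous.intervalIntegrable (by fun_prop) _ _
  have hcos : ∀ j, 0 ≤ ∫ t in (0 : ℝ)..δ, w j * (1 - Real.cos (t * a j)) := fun j =>
    intervalIntegral.integral_nonneg hδ.le fun t _ =>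
      mul_nonneg (hw j) (by linarith [Real.cos_le_one (t * a j)])
  have hc : Summable fun j => ∫ t in (0 : ℝ)..δ, w j * (1 - Real.cos (t * a j)) := by
    refine summable_of_sum_le hcos (c := δ * K) fun F => ?_
    rw [← intervalIntegral.integral_finsetSum fun j _ => hint j]
    calc _ ≤ ∫ t in (0 : ℝ)..δ, K := by
          refine intervalIntegral.integral_mono_on hδ.le
            (Continuous.intervalIntegrable (by fun_prop) _ _) (by simp) fun t ht => ?_
          refine le_trans ?_ (hK t (by rw [abs_of_nonneg ht.1]; exact ht.2))
          refine le_trans (Finset.sum_le_sum fun j _ => ?_)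
            ((hs t).sum_le_tsum F fun j _ => mul_nonneg (hw j) (norm_nonneg _))
          exact mul_le_mul_of_nonneg_left (one_sub_cos_le_norm_exp_I_mul_sub_one _) (hw j)
      _ = δ * K := by simp
  -- Majorant for `|t| ≤ 1`. If `δ|a j| ≥ 2`, the chord is at most `2` and the integral at least `w
  -- j * δ/2`, whence `4/δ`. Otherwise the chord at `t` is at most `|a j|`, which the chord at `δ`
  -- controls up to `π/(2δ)`.
  have hbound : Summable fun j => 4 / δ * (∫ t in (0 : ℝ)..δ, w j * (1 - Real.cos (t * a j))) +
      Real.pi / (2 * δ) * (w j * ‖Complex.exp (Complex.I * ((δ * a j : ℝ) : ℂ)) - 1‖) :=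
    (hc.mul_left _).add ((hs δ).mul_left _)
  have key := tendsto_tsum_of_dominated_convergence (𝓕 := 𝓝 (0 : ℝ))
    (f := fun t j => w j * ‖Complex.exp (Complex.I * ((t * a j : ℝ) : ℂ)) - 1‖)
    (g := fun _ => 0) hbound (fun j => ?_) ?_
  · simpa using key
  · have : Continuous fun t : ℝ => w j * ‖Complex.exp (Complex.I * ((t * a j : ℝ) : ℂ)) - 1‖ := by
      fun_prop
    simpa using this.tendsto 0
  · filter_upwards [Metric.closedBall_mem_nhds (0 : ℝ) one_pos] with t ht j
    rw [mem_closedBall_zero_iff, Real.norm_eq_abs] at ht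
    rw [Real.norm_of_nonneg (mul_nonneg (hw j) (norm_nonneg _))]
    have hpi := Real.pi_pos
    rcases le_total 2 (δ * |a j|) with h | h
    · have h1 := half_le_integral_one_sub_cos hδ h
      have h2 : 0 ≤ Real.pi / (2 * δ) *
          (w j * ‖Complex.exp (Complex.I * ((δ * a j : ℝ) : ℂ)) - 1‖) :=
        mul_nonneg (by positivity) (mul_nonneg (hw j) (norm_nonneg _))
      rw [intervalIntegral.integral_const_mul]
      calc _ ≤ w j * 2 := mul_le_mul_of_nonneg_left (norm_exp_I_mul_sub_one_le_two _) (hw j)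
        _ = 4 / δ * (w j * (δ / 2)) := by field_simp; ring
        _ ≤ 4 / δ * (w j * ∫ t in (0 : ℝ)..δ, (1 - Real.cos (t * a j))) :=
          mul_le_mul_of_nonneg_left (mul_le_mul_of_nonneg_left h1 (hw j)) (by positivity)
        _ ≤ _ := le_add_of_nonneg_right h2
    · have h1 := abs_le_mul_norm_exp_I_mul_sub_one (x := δ * a j)
        (by rwa [abs_mul, abs_of_pos hδ])
      have h2 : 0 ≤ 4 / δ * ∫ t in (0 : ℝ)..δ, w j * (1 - Real.cos (t * a j)) :=
        mul_nonneg (by positivity) (hcos j)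
      refine le_add_of_nonneg_of_le h2 ?_
      calc _ ≤ w j * |a j| := by
            refine mul_le_mul_of_nonneg_left ?_ (hw j)
            refine Real.norm_exp_I_mul_ofReal_sub_one_le.trans ?_
            rw [Real.norm_eq_abs, abs_mul]
            exact mul_le_of_le_one_left (abs_nonneg _) ht
        _ = 1 / δ * (w j * |δ * a j|) := by rw [abs_mul, abs_of_pos hδ]; field_simp
        _ ≤ 1 / δ * (w j *
            (Real.pi / 2 * ‖Complex.exp (Complex.I * ((δ * a j : ℝ) : ℂ)) - 1‖)) :=
          mul_le_mul_of_nonneg_left (mul_le_mul_of_nonneg_left h1 (hw j)) (by positivity)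
        _ = _ := by field_simp

end WeightedChords

/-! ### From characteristic functions to limit distributions -/

/-- **Lévy's continuity theorem** on the line. -/
lemma exists_tendsto_of_tendsto_charFun {μ : ℕ → ProbabilityMeasure ℝ} {φ : ℝ → ℂ}
    (hφ : ContinuousAt φ 0)
    (h : ∀ t, Tendsto (fun n => charFun (μ n : Measure ℝ) t) atTop (𝓝 (φ t))) :
    ∃ ν : ProbabilityMeasure ℝ, Tendsto μ atTop (𝓝 ν) ∧ charFun (ν : Measure ℝ) = φ := by
  have htight : IsTightMeasureSet {((ρ : ProbabilityMeasure ℝ) : Measure ℝ) | ρ ∈ Set.range μ} := by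
    have := isTightMeasureSet_of_tendsto_charFun (μ := fun n => (μ n : Measure ℝ)) hφ h
    convert this using 1
    ext ρ
    simp
  have hcomp := isCompact_closure_of_isTightMeasureSet htight
  -- A limit along one ultrafilter is enough: it shows that `φ` is a characteristic function.
  obtain ⟨ν, -, hν⟩ := hcomp.ultrafilter_le_nhds ((hyperfilter ℕ).map μ)
    (le_principal_iff.2 (Filter.mem_of_superset (Filter.range_mem_map) subset_closure))
  have hν' : Tendsto μ (hyperfilter ℕ : Filter ℕ) (𝓝 ν) := hν
  have hchar : charFun (ν : Measure ℝ) = φ := by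
    funext t
    have h1 : Tendsto (fun n => charFun (μ n : Measure ℝ) t) (hyperfilter ℕ : Filter ℕ)
        (𝓝 (charFun (ν : Measure ℝ) t)) := by
      rw [ProbabilityMeasure.tendsto_iff_forall_integral_rclike_tendsto ℂ] at hν'
      simp_rw [charFun_eq_integral_innerProbChar]
      exact hν' _
    exact tendsto_nhds_unique h1 ((h t).mono_left Nat.hyperfilter_le_atTop)
  refine ⟨ν, ProbabilityMeasure.tendsto_of_tendsto_charFun fun t => ?_, hchar⟩
  rw [hchar]
  exact h t

lemma measure_singleton_eq_zero_of_continuousAt_cdf {μ : Measure ℝ} [IsProbabilityMeasure μ]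
    {y : ℝ} (h : ContinuousAt (cdf μ) y) : μ {y} = 0 := by
  rw [← measure_cdf μ, StieltjesFunction.measure_singleton,
    h.continuousWithinAt.leftLim_eq, sub_self, ENNReal.ofReal_zero]

lemma tendsto_measureReal_Iic {μ : ℕ → ProbabilityMeasure ℝ} {ν : ProbabilityMeasure ℝ}
    (h : Tendsto μ atTop (𝓝 ν)) {y : ℝ} (hy : ContinuousAt (cdf (ν : Measure ℝ)) y) :
    Tendsto (fun n => (μ n : Measure ℝ).real (Set.Iic y)) atTop (𝓝 (cdf (ν : Measure ℝ) y)) := by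
  rw [cdf_eq_real]
  have h0 := ProbabilityMeasure.tendsto_measure_of_null_frontier_of_tendsto' h
    (E := Set.Iic y) (by
      rw [frontier_Iic]
      exact measure_singleton_eq_zero_of_continuousAt_cdf hy)
  exact (ENNReal.tendsto_toReal (measure_ne_top _ _)).comp h0

/-- The law of `f` under the uniform probability on `{1, …, n}`. -/
noncomputable def empiricalMeasure (f : ArithmeticFunction ℝ) (n : ℕ) : Measure ℝ :=
  (n : ENNReal)⁻¹ • ∑ m ∈ Finset.Icc 1 n, Measure.dirac (f m)

lemma isProbabilityMeasure_empiricalMeasure (f : ArithmeticFunction ℝ) {n : ℕ} (hn : n ≠ 0) :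
    IsProbabilityMeasure (empiricalMeasure f n) := by
  constructor
  simp [empiricalMeasure, ENNReal.inv_mul_cancel (Nat.cast_ne_zero.2 hn) (ENNReal.natCast_ne_top n)]

lemma empiricalMeasure_real_Iic (f : ArithmeticFunction ℝ) (n : ℕ) (y : ℝ) :
    (empiricalMeasure f n).real (Set.Iic y) = empiricalCDF f n y := by
  simp only [empiricalMeasure, Measure.real, Measure.smul_apply, Measure.finsetSum_apply,
    Measure.dirac_apply' _ measurableSet_Iic, Set.indicator_apply, Set.mem_Iic, Pi.one_apply,
    smul_eq_mul, ENNReal.toReal_mul, ENNReal.toReal_inv, ENNReal.toReal_natCast, empiricalCDF]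
  rw [Finset.sum_boole, ENNReal.toReal_natCast, div_eq_inv_mul]

lemma charFun_empiricalMeasure (f : ArithmeticFunction ℝ) (n : ℕ) (t : ℝ) :
    charFun (empiricalMeasure f n) t = (n : ℂ)⁻¹ * ∑ m ∈ Finset.Icc 1 n, expTwist f t m := by
  rw [charFun_apply_real, empiricalMeasure, integral_smul_measure,
    integral_finsetSum_measure fun m _ => integrable_dirac (by simp)]
  simp only [integral_dirac, ENNReal.toReal_inv, ENNReal.toReal_natCast, expTwist,
    Complex.real_smul, Complex.ofReal_inv, Complex.ofReal_natCast]
  congr 1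
  refine Finset.sum_congr rfl fun m _ => ?_
  congr 1
  ring

/-- Convergence of the mean values of `e^{itf}` to a function continuous at `0` yields a limit
distribution with that characteristic function. -/
lemma exists_hasLimitDistribution {f : ArithmeticFunction ℝ} {φ : ℝ → ℂ} (hφ : ContinuousAt φ 0)
    (h : ∀ t, Tendsto (fun n : ℕ => (n : ℂ)⁻¹ * ∑ m ∈ Finset.Icc 1 n, expTwist f t m) atTop
      (𝓝 (φ t))) :
    ∃ μ : Measure ℝ, HasLimitDistribution f μ ∧ charFun μ = φ := by
  -- The shift avoids `n = 0`, where the empirical measure is zero.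
  let μ : ℕ → ProbabilityMeasure ℝ := fun n =>
    ⟨empiricalMeasure f (n + 1), isProbabilityMeasure_empiricalMeasure f n.succ_ne_zero⟩
  obtain ⟨ν, hν, hchar⟩ := exists_tendsto_of_tendsto_charFun (μ := μ) hφ fun t => by
    have := (tendsto_add_atTop_iff_nat 1).2 (h t)
    refine this.congr fun n => ?_
    exact (charFun_empiricalMeasure f (n + 1) t).symm
  refine ⟨ν, ⟨inferInstance, fun y hy => ?_⟩, hchar⟩
  rw [← tendsto_add_atTop_iff_nat 1]
  refine (tendsto_measureReal_Iic hν hy).congr fun n => ?_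
  exact empiricalMeasure_real_Iic f (n + 1) y

/-! ### Mean values and Euler products -/

section MeanValue

open scoped ArithmeticFunction.zeta ArithmeticFunction.Moebius

/-- A nonnegative multiplicative function that is summable over the prime powers is summable, and
its sum is at most the exponential of the sum over the prime powers. -/
lemma summable_and_tsum_le_exp_of_multiplicative {F : ℕ → ℝ} (hnn : ∀ n, 0 ≤ F n) (h0 : F 0 = 0)
    (h1 : F 1 = 1) (hmul : ∀ {m n : ℕ}, Nat.Coprime m n → F (m * n) = F m * F n)
    (hs : Summable fun x : Nat.Primes × ℕ => F ((x.1 : ℕ) ^ (x.2 + 1))) :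
    Summable F ∧ ∑' n, F n ≤ Real.exp (∑' x : Nat.Primes × ℕ, F ((x.1 : ℕ) ^ (x.2 + 1))) := by
  have hp : ∀ {p : ℕ}, p.Prime → Summable fun k : ℕ => F (p ^ (k + 1)) := fun {p} hp =>
    hs.prod_factor ⟨p, hp⟩
  have hp' : ∀ {p : ℕ}, p.Prime → Summable fun k : ℕ => F (p ^ k) := fun {p} hpp =>
    (summable_nat_add_iff 1).1 (hp hpp)
  have hbound : ∀ s : Finset ℕ, ∑ n ∈ s, F n ≤
      Real.exp (∑' x : Nat.Primes × ℕ, F ((x.1 : ℕ) ^ (x.2 + 1))) := by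
    intro s
    -- Every nonzero element of `s` is then `N`-smooth, so the finite Euler product bounds the sum.
    set N := s.sup id + 1 with hN
    obtain ⟨hsm, hprod⟩ := EulerProduct.summable_and_hasSum_smoothNumbers_prod_primesBelow_tsum
      h1 hmul (fun {p} hpp => (hp' hpp).norm) N
    have hle : ∑ n ∈ s, F n ≤ ∑' m : N.smoothNumbers, F m := by
      classical
      have hmem : ∀ n ∈ s.erase 0, n ∈ N.smoothNumbers := by
        intro n hn
        rw [Finset.mem_erase] at hn
        rw [Nat.mem_smoothNumbers']
        intro p _ hpn
        exact Nat.lt_succ_of_le ((Nat.le_of_dvd (Nat.pos_of_ne_zero hn.1) hpn).trans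
          (Finset.le_sup (f := id) hn.2))
      rw [← Finset.sum_erase s h0, ← Finset.sum_subtype_of_mem (p := (· ∈ N.smoothNumbers)) F hmem]
      exact hprod.summable.sum_le_tsum _ fun m _ => hnn m
    refine hle.trans ?_
    rw [hprod.tsum_eq]
    have hfac : ∀ p ∈ N.primesBelow, ∑' n : ℕ, F (p ^ n) = 1 + ∑' k : ℕ, F (p ^ (k + 1)) := by
      intro p hpN
      rw [(hp' (Nat.prime_of_mem_primesBelow hpN)).tsum_eq_zero_add, pow_zero, h1]
    rw [Finset.prod_congr rfl hfac]
    refine (Real.prod_one_add_le_exp_sum _ fun p => tsum_nonneg fun k => hnn _).trans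
      (Real.exp_le_exp.2 ?_)
    rw [hs.tsum_prod, ← Finset.sum_subtype_of_mem (p := Nat.Prime)
      (fun p => ∑' k : ℕ, F (p ^ (k + 1))) fun p => Nat.prime_of_mem_primesBelow]
    exact Summable.sum_le_tsum (ι := Nat.Primes) _ (fun p _ => tsum_nonneg fun k => hnn _) hs.prod
  exact ⟨summable_of_sum_le hnn hbound, Real.tsum_le_of_sum_le hnn hbound⟩

/-- **Wintner's mean value theorem**: if `∑ h(d) / d` converges absolutely, then `h * ζ` has the
mean value `∑ h(d) / d`. -/
lemma tendsto_mean_mul_zeta {h : ArithmeticFunction ℂ} (hs : Summable fun n : ℕ => ‖h n / n‖) :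
    Tendsto (fun N : ℕ => (N : ℂ)⁻¹ * ∑ n ∈ Finset.Icc 1 N,
      (h * (ζ : ArithmeticFunction ℂ)) n) atTop (𝓝 (∑' n : ℕ, h n / n)) := by
  have heq : ∀ N : ℕ, (N : ℂ)⁻¹ * ∑ n ∈ Finset.Icc 1 N, (h * (ζ : ArithmeticFunction ℂ)) n =
      ∑' d : ℕ, (N : ℂ)⁻¹ * (h d * ((N / d : ℕ) : ℂ)) := by
    intro N
    rw [show Finset.Icc 1 N = Finset.Ioc 0 N from rfl,
      ArithmeticFunction.sum_Ioc_mul_zeta_eq_sum, Finset.mul_sum]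
    refine (tsum_eq_sum fun d hd => ?_).symm
    rw [Finset.mem_Ioc, not_and_or, not_lt, not_le, Nat.le_zero] at hd
    rcases hd with rfl | hd
    · simp
    · simp [Nat.div_eq_of_lt hd]
  simp_rw [heq]
  -- Termwise `⌊N/d⌋/N` tends to `1/d` and never exceeds it.
  refine tendsto_tsum_of_dominated_convergence hs (fun d => ?_) (Eventually.of_forall fun N d => ?_)
  · rcases Nat.eq_zero_or_pos d with rfl | hd
    · simp
    have hlim : Tendsto (fun N : ℕ => ((N / d : ℕ) : ℝ) / N) atTop (𝓝 (1 / d)) := by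
      have h1 := (tendsto_nat_floor_mul_div_atTop (R := ℝ) (a := 1 / d) (by positivity)).comp
        tendsto_natCast_atTop_atTop (α := ℕ)
      refine h1.congr fun N => ?_
      simp only [Function.comp_apply]
      rw [one_div, inv_mul_eq_div, Nat.floor_div_eq_div]
    have hlim' := (Complex.continuous_ofReal.tendsto _).comp hlim
    have := hlim'.const_mul (h d)
    refine (this.congr fun N => ?_).trans (le_of_eq ?_)
    · simp only [Function.comp_apply, Complex.ofReal_div, Complex.ofReal_natCast]
      ring
    · congr 1
      push_cast
      ring
  · rw [norm_mul, norm_mul, norm_inv, norm_div, Complex.norm_natCast, Complex.norm_natCast,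
      Complex.norm_natCast]
    have h1 : ((N / d : ℕ) : ℝ) ≤ N / d := Nat.cast_div_le
    rcases Nat.eq_zero_or_pos N with rfl | hN
    · simp only [CharP.cast_eq_zero, inv_zero, zero_mul]; positivity
    calc (N : ℝ)⁻¹ * (‖h d‖ * ((N / d : ℕ) : ℝ)) ≤ (N : ℝ)⁻¹ * (‖h d‖ * (N / d)) := by gcongr
      _ = ‖h d‖ / d := by field_simp

/-- Summation by parts: it matches the Euler factor of `h_t` with `localFactor`. -/
lemma tsum_sub_div_pow {u : ℕ → ℂ} (hu : ∀ k, ‖u k‖ ≤ 1) {p : ℕ} (hp : 1 < p) :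
    u 0 + ∑' k : ℕ, (u (k + 1) - u k) / (p : ℂ) ^ (k + 1) =
      (1 - 1 / (p : ℂ)) * ∑' k : ℕ, u k / (p : ℂ) ^ k := by
  have hp0 : (p : ℂ) ≠ 0 := by exact_mod_cast (by omega : p ≠ 0)
  have hs : Summable fun k : ℕ => u k / (p : ℂ) ^ k := by
    refine Summable.of_norm_bounded (g := fun k : ℕ => ((p : ℝ)⁻¹) ^ k)
      (summable_geometric_of_lt_one (by positivity) (inv_lt_one_of_one_lt₀ (by exact_mod_cast hp)))
      fun k => ?_
    rw [norm_div, norm_pow, Complex.norm_natCast, inv_pow, ← one_div]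
    gcongr
    exact hu k
  have hs1 := (summable_nat_add_iff 1).2 hs
  have heq : ∀ k, (u (k + 1) - u k) / (p : ℂ) ^ (k + 1) =
      u (k + 1) / (p : ℂ) ^ (k + 1) - 1 / (p : ℂ) * (u k / (p : ℂ) ^ k) := fun k => by
    field_simp
    ring
  simp_rw [heq]
  rw [hs1.tsum_sub (hs.mul_left _), tsum_mul_left, sub_mul, one_mul]
  nth_rewrite 2 [hs.tsum_eq_zero_add]
  simp
  ring

lemma norm_expTwist (f : ArithmeticFunction ℝ) (t : ℝ) (n : ℕ) : ‖expTwist f t n‖ = 1 := by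
  rw [expTwist, mul_assoc, ← Complex.ofReal_mul, Complex.norm_exp_I_mul_ofReal]

lemma norm_expTwist_sub (f : ArithmeticFunction ℝ) (t : ℝ) (m n : ℕ) :
    ‖expTwist f t m - expTwist f t n‖ =
      ‖Complex.exp (Complex.I * ((t * (f m - f n) : ℝ) : ℂ)) - 1‖ := by
  have h : expTwist f t m - expTwist f t n =
      expTwist f t n * (Complex.exp (Complex.I * ((t * (f m - f n) : ℝ) : ℂ)) - 1) := by
    rw [mul_sub, mul_one, expTwist, expTwist, ← Complex.exp_add]
    push_cast
    ring_nf
  rw [h, norm_mul, norm_expTwist, one_mul]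

/-- The arithmetic function `n ↦ e^{itf(n)}`. -/
noncomputable def twist (f : ArithmeticFunction ℝ) (t : ℝ) : ArithmeticFunction ℂ :=
  ⟨fun n => if n = 0 then 0 else expTwist f t n, by simp⟩

lemma twist_apply {f : ArithmeticFunction ℝ} {t : ℝ} {n : ℕ} (hn : n ≠ 0) :
    twist f t n = expTwist f t n := by
  simp [twist, hn]

lemma expTwist_one {f : ArithmeticFunction ℝ} (hf : IsAdditiveArith f) (t : ℝ) :
    expTwist f t 1 = 1 := by
  simp [expTwist, hf.1]

lemma isMultiplicative_twist {f : ArithmeticFunction ℝ} (hf : IsAdditiveArith f) (t : ℝ) :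
    (twist f t).IsMultiplicative := by
  rw [ArithmeticFunction.IsMultiplicative.iff_ne_zero]
  refine ⟨by rw [twist_apply one_ne_zero, expTwist_one hf], fun {m n} hm hn hmn => ?_⟩
  rw [twist_apply (mul_ne_zero hm hn), twist_apply hm, twist_apply hn, expTwist, expTwist,
    expTwist, hf.2 m n hmn, ← Complex.exp_add]
  push_cast
  ring_nf

/-- The Dirichlet quotient of `e^{itf}` by `ζ`. -/
noncomputable def twistQuotient (f : ArithmeticFunction ℝ) (t : ℝ) : ArithmeticFunction ℂ :=
  twist f t * (μ : ArithmeticFunction ℂ)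

lemma twistQuotient_mul_zeta (f : ArithmeticFunction ℝ) (t : ℝ) :
    twistQuotient f t * (ζ : ArithmeticFunction ℂ) = twist f t := by
  rw [twistQuotient, mul_assoc, ArithmeticFunction.coe_moebius_mul_coe_zeta, mul_one]

lemma isMultiplicative_twistQuotient {f : ArithmeticFunction ℝ} (hf : IsAdditiveArith f) (t : ℝ) :
    (twistQuotient f t).IsMultiplicative :=
  (isMultiplicative_twist hf t).mul ArithmeticFunction.isMultiplicative_moebius.intCast

lemma twistQuotient_prime_pow_succ (f : ArithmeticFunction ℝ) (t : ℝ) {p : ℕ} (hp : p.Prime)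
    (k : ℕ) : twistQuotient f t (p ^ (k + 1)) =
      expTwist f t (p ^ (k + 1)) - expTwist f t (p ^ k) := by
  have h : ∀ j, expTwist f t (p ^ j) = ∑ i ∈ Finset.range (j + 1), twistQuotient f t (p ^ i) := by
    intro j
    rw [← twist_apply (pow_ne_zero j hp.ne_zero), ← twistQuotient_mul_zeta,
      ArithmeticFunction.coe_mul_zeta_apply, Nat.sum_divisors_prime_pow hp]
  rw [h, h, Finset.sum_range_succ _ (k + 1), add_sub_cancel_left]

variable {f : ArithmeticFunction ℝ}

lemma norm_twistQuotient_div_prime_pow_succ (t : ℝ) (x : Nat.Primes × ℕ) :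
    ‖twistQuotient f t ((x.1 : ℕ) ^ (x.2 + 1)) / (((x.1 : ℕ) ^ (x.2 + 1) : ℕ) : ℂ)‖ =
      ‖expTwist f t ((x.1 : ℕ) ^ (x.2 + 1)) - expTwist f t ((x.1 : ℕ) ^ x.2)‖
        / ((x.1 : ℕ) : ℝ) ^ (x.2 + 1) := by
  rw [twistQuotient_prime_pow_succ f t x.1.2, norm_div, Complex.norm_natCast, Nat.cast_pow]

lemma twistQuotient_div_mul (hf : IsAdditiveArith f) (t : ℝ) {m n : ℕ} (hmn : Nat.Coprime m n) :
    twistQuotient f t (m * n) / ((m * n : ℕ) : ℂ) =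
      twistQuotient f t m / m * (twistQuotient f t n / n) := by
  rw [(isMultiplicative_twistQuotient hf t).2 hmn, Nat.cast_mul, mul_div_mul_comm]

lemma summable_and_tsum_norm_twistQuotient_div_le (hf : IsAdditiveArith f) {t : ℝ}
    (hsum : Summable (fun x : Nat.Primes × ℕ =>
      ‖expTwist f t ((x.1 : ℕ) ^ (x.2 + 1)) - expTwist f t ((x.1 : ℕ) ^ x.2)‖
        / ((x.1 : ℕ) : ℝ) ^ (x.2 + 1))) :
    Summable (fun n : ℕ => ‖twistQuotient f t n / n‖) ∧
      ∑' n : ℕ, ‖twistQuotient f t n / n‖ ≤ Real.exp (∑' x : Nat.Primes × ℕ,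
        ‖expTwist f t ((x.1 : ℕ) ^ (x.2 + 1)) - expTwist f t ((x.1 : ℕ) ^ x.2)‖
          / ((x.1 : ℕ) : ℝ) ^ (x.2 + 1)) := by
  simp_rw [← norm_twistQuotient_div_prime_pow_succ t] at hsum ⊢
  refine summable_and_tsum_le_exp_of_multiplicative (F := fun n : ℕ => ‖twistQuotient f t n / n‖)
    (fun n => norm_nonneg _) (by simp) ?_ (fun {m n} hmn => ?_) hsum
  · simp [(isMultiplicative_twistQuotient hf t).1]
  · rw [twistQuotient_div_mul hf t hmn, norm_mul]

lemma localFactor_eq_tsum (hf : IsAdditiveArith f) (t : ℝ) {p : ℕ} (hp : p.Prime)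
    (hs : Summable fun k : ℕ => twistQuotient f t (p ^ k) / ((p ^ k : ℕ) : ℂ)) :
    localFactor f t p = ∑' k : ℕ, twistQuotient f t (p ^ k) / ((p ^ k : ℕ) : ℂ) := by
  rw [localFactor, ← tsum_sub_div_pow (u := fun k => expTwist f t (p ^ k))
    (fun k => (norm_expTwist f t _).le) hp.one_lt, hs.tsum_eq_zero_add]
  simp only [twistQuotient_prime_pow_succ f t hp, pow_zero, expTwist_one hf,
    (isMultiplicative_twistQuotient hf t).1, Nat.cast_pow, Nat.cast_one, div_one]

lemma hasProd_localFactor (hf : IsAdditiveArith f) {t : ℝ}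
    (hs : Summable fun n : ℕ => ‖twistQuotient f t n / n‖) :
    HasProd (fun p : Nat.Primes => localFactor f t (p : ℕ))
      (∑' n : ℕ, twistQuotient f t n / n) := by
  have h := EulerProduct.eulerProduct_hasProd (f := fun n : ℕ => twistQuotient f t n / n)
    (by simp [(isMultiplicative_twistQuotient hf t).1])
    (fun {m n} hmn => twistQuotient_div_mul hf t hmn) hs (by simp)
  convert h using 2 with p
  exact localFactor_eq_tsum hf t p.2
    (hs.of_norm.comp_injective (Nat.pow_right_injective p.2.two_le))

/-- The mean value `∑ h_t(d) / d` of `e^{itf}` is continuous at `t = 0`. -/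
lemma continuousAt_tsum_twistQuotient_div (hf : IsAdditiveArith f)
    (hsum : ∀ t : ℝ, Summable (fun x : Nat.Primes × ℕ =>
      ‖expTwist f t ((x.1 : ℕ) ^ (x.2 + 1)) - expTwist f t ((x.1 : ℕ) ^ x.2)‖
        / ((x.1 : ℕ) : ℝ) ^ (x.2 + 1))) :
    ContinuousAt (fun t : ℝ => ∑' n : ℕ, twistQuotient f t n / n) 0 := by
  set S : ℝ → ℝ := fun t => ∑' x : Nat.Primes × ℕ,
    ‖expTwist f t ((x.1 : ℕ) ^ (x.2 + 1)) - expTwist f t ((x.1 : ℕ) ^ x.2)‖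
      / ((x.1 : ℕ) : ℝ) ^ (x.2 + 1) with hS
  have hS0 : Tendsto S (𝓝 0) (𝓝 0) := by
    rw [hS]
    -- Each term is a chord with weight `p^-(k+1)` and frequency `f(p^(k+1)) - f(p^k)`.
    simp_rw [norm_expTwist_sub, div_eq_inv_mul] at hsum ⊢
    exact tendsto_tsum_chord (fun x => by positivity) hsum
  have hle : ∀ t, ‖(∑' n : ℕ, twistQuotient f t n / n) - 1‖ ≤ Real.exp (S t) - 1 := by
    intro t
    obtain ⟨hs, hexp⟩ := summable_and_tsum_norm_twistQuotient_div_le hf (hsum t)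
    have hone : twistQuotient f t 1 = 1 := (isMultiplicative_twistQuotient hf t).1
    -- The terms `n = 0, 1` contribute `0` and `1`; the tail is at most the sum of norms minus `1`.
    have h1 := hs.of_norm.sum_add_tsum_nat_add 2
    have h2 := hs.sum_add_tsum_nat_add 2
    simp only [Finset.sum_range_succ, Finset.range_zero, Finset.sum_empty, hone,
      ArithmeticFunction.map_zero, Nat.cast_zero, Nat.cast_one, div_one, zero_div, norm_zero,
      norm_one, zero_add] at h1 h2
    rw [← h1, add_sub_cancel_left]
    refine (norm_tsum_le_tsum_norm
      ((summable_nat_add_iff (f := fun n : ℕ => ‖twistQuotient f t n / n‖) 2).2 hs)).trans ?_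
    linarith
  have hlim : Tendsto (fun t : ℝ => ∑' n : ℕ, twistQuotient f t n / n) (𝓝 0) (𝓝 1) := by
    rw [tendsto_iff_norm_sub_tendsto_zero]
    refine squeeze_zero (fun t => norm_nonneg _) hle ?_
    have := ((Real.continuous_exp.tendsto 0).comp hS0).sub_const 1
    simpa using this
  exact continuousAt_of_tendsto_nhds hlim

lemma tendsto_mean_expTwist {t : ℝ} (hs : Summable fun n : ℕ => ‖twistQuotient f t n / n‖) :
    Tendsto (fun n : ℕ => (n : ℂ)⁻¹ * ∑ m ∈ Finset.Icc 1 n, expTwist f t m) atTop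
      (𝓝 (∑' n : ℕ, twistQuotient f t n / n)) := by
  refine (tendsto_mean_mul_zeta hs).congr fun n => ?_
  rw [twistQuotient_mul_zeta]
  congr 1
  exact Finset.sum_congr rfl fun m hm =>
    twist_apply (Nat.one_le_iff_ne_zero.1 (Finset.mem_Icc.1 hm).1)

end MeanValue

/- The pair `(p, k)` of the summability condition stands for the prime power `p ^ (k + 1)`. -/
theorem mainTheorem2 (f : ArithmeticFunction ℝ) (hf : IsAdditiveArith f)
    (hsum : ∀ t : ℝ, Summable (fun x : Nat.Primes × ℕ =>
      ‖expTwist f t ((x.1 : ℕ) ^ (x.2 + 1)) - expTwist f t ((x.1 : ℕ) ^ x.2)‖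
        / ((x.1 : ℕ) : ℝ) ^ (x.2 + 1))) :
    ∃ μ : Measure ℝ, HasLimitDistribution f μ ∧
      ∀ t : ℝ, HasProd (fun p : Nat.Primes => localFactor f t (p : ℕ)) (charFun μ t) := by
  have hs := fun t => (summable_and_tsum_norm_twistQuotient_div_le hf (hsum t)).1
  obtain ⟨μ, hμ, hchar⟩ := exists_hasLimitDistribution
    (continuousAt_tsum_twistQuotient_div hf hsum) fun t => tendsto_mean_expTwist (hs t)
  refine ⟨μ, hμ, fun t => ?_⟩
  rw [hchar]
  exact hasProd_localFactor hf (hs t)
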